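/- Let $(X,d)$ be a metric space and let $\mu$ be a Borel measure on $X$ with $0<\mu(B(x,r))<\infty$ for every open ball $B(x,r)=\{y : d(x,y)<r\}$, $x\in X$, $r>0$. Assume that $\mu$ is doubling: there is a constant $c_\mu>1$ with $\mu(B(x,2r))\le c_\mu\,\mu(B(x,r))$ for all $x\in X$ and $r>0$. Let $E\subset X$ be nonempty, and put $\rho_E=\operatorname{diam}(E)$ if $\operatorname{diam}(E)>0$ and $\rho_E=\operatorname{diam}(X)$ if $\operatorname{diam}(E)=0$ (so $\rho_E\in[0,\infty]$). Write $\operatorname{dist}(x,E)=\inf_{y\in E}d(x,y)$ and $E_r=\{x\in X : \operatorname{dist}(x,E)<r\}$. The upper Assouad codimension $\overline{\operatorname{co\,dim}}_A(E)$ is the infimum of all $Q\ge 0$ for which there is a constant $c>0$ such that $$\frac{\mu(E_r\cap B(z,R))}{\mu(B(z,R))}\ge c\Bigl(\frac rR\Bigr)^Q\qquad\text{for every } z\in E \text{ and all } 0<r<R<\rho_E.$$ For $\alpha>0$, the set $E$ satisfies the upper Aikawa condition with exponent $\alpha$ if for every $\varepsilon>0$ there is $\delta>0$ such that $$\frac1{\mu(B(z,R))}\int_{B(z,R)}\frac{\mathbf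 1_K(y)}{\operatorname{dist}(y,E)^{\alpha}}\,d\mu(y)\ge\frac{R^{-\alpha}}{\varepsilon}$$ whenever $z\in E$, $0<R<\rho_E$ and $K\subset X$ is a Borel set with $\mu(B(z,R)\setminus K)\le\delta\,\mu(B(z,R))$. Here the integral takes values in $[0,\infty]$, with $\operatorname{dist}(y,E)^{-\alpha}=\infty$ when $\operatorname{dist}(y,E)=0$. Then $$\overline{\operatorname{co\,dim}}_A(E)=\inf\{\alpha>0 : E\text{ satisfies the upper Aikawa condition with exponent }\alpha\}.$$ -/

import Mathlib

open Set MeasureTheory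
open scoped ENNReal

/-- `μ` gives every open ball positive finite measure and is doubling: there is a constant `c > 1`
with `μ (B(x, 2r)) ≤ c * μ (B(x, r))` for all `x` and all `r > 0`. -/
structure IsDoublingMeasure {X : Type*} [MetricSpace X] [MeasurableSpace X]
    (μ : Measure X) : Prop where
  ball_pos : ∀ (x : X) (r : ℝ), 0 < r → 0 < μ (Metric.ball x r)
  ball_lt_top : ∀ (x : X) (r : ℝ), 0 < r → μ (Metric.ball x r) < ∞
  doubling : ∃ c : ℝ, 1 < c ∧ ∀ (x : X) (r : ℝ), 0 < r →
    μ (Metric.ball x (2 * r)) ≤ ENNReal.ofReal c * μ (Metric.ball x r)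

/-- The (strict) upper bound for the admissible radii: `diam E` if this is positive, and
`diam X` if `diam E = 0`. It may be infinite. -/
noncomputable def radiusBound {X : Type*} [MetricSpace X] (E : Set X) : ℝ≥0∞ :=
  if Metric.ediam E = 0 then Metric.ediam (univ : Set X) else Metric.ediam E

/-- For some `c > 0`, `μ (E_r ∩ B(z, R)) / μ (B(z, R)) ≥ c (r / R) ^ Q` for every `z ∈ E` and all
`0 < r < R` with `R` below `radiusBound E`. Here `E_r = {x | dist(x, E) < r}`. -/
def HasAssouadLowerBound {X : Type*} [MetricSpace X] [MeasurableSpace X]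
    (μ : Measure X) (E : Set X) (Q : ℝ) : Prop :=
  ∃ c : ℝ, 0 < c ∧ ∀ z ∈ E, ∀ r R : ℝ, 0 < r → r < R → ENNReal.ofReal R < radiusBound E →
    ENNReal.ofReal (c * (r / R) ^ Q) ≤
      μ (Metric.thickening r E ∩ Metric.ball z R) / μ (Metric.ball z R)

/-- The upper Assouad codimension, as an infimum in `[0, ∞]` (so that the infimum of the empty
set is `∞`). -/
noncomputable def upperAssouadCodim {X : Type*} [MetricSpace X] [MeasurableSpace X]
    (μ : Measure X) (E : Set X) : ℝ≥0∞ :=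
  sInf (ENNReal.ofReal '' {Q : ℝ | 0 ≤ Q ∧ HasAssouadLowerBound μ E Q})

/-- The upper Aikawa condition with exponent `α`, meant for `α > 0`. The integrand takes values
in `[0, ∞]`: for `α > 0`, `dist(y, E) ^ (-α) = ∞` where `dist(y, E) = 0`. -/
def UpperAikawa {X : Type*} [MetricSpace X] [MeasurableSpace X]
    (μ : Measure X) (E : Set X) (α : ℝ) : Prop :=
  ∀ ε : ℝ, 0 < ε → ∃ δ : ℝ, 0 < δ ∧
    ∀ z ∈ E, ∀ R : ℝ, 0 < R → ENNReal.ofReal R < radiusBound E →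
      ∀ K : Set X, MeasurableSet K →
        μ (Metric.ball z R \ K) ≤ ENNReal.ofReal δ * μ (Metric.ball z R) →
        ENNReal.ofReal (R ^ (-α) / ε) ≤
          ⨍⁻ y in Metric.ball z R, K.indicator (fun y => Metric.infEDist y E ^ (-α)) y ∂μ

/-! Each exponent admissible for one infimum makes every larger one admissible for the other. From a
lower bound with `Q < α`: removing half of the guaranteed mass of `E_{tR}` leaves a set where the
integrand is at least `(tR)^(-α)`, and `t^(Q-α)` is as large as desired. From Aikawa with `α < Q`:
if `E_r` is thin in a ball, test with `K` its complement. Were all intermediate neighbourhoods thin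
as well, a dyadic sum would make the integral too small. So some scale `s` has mass at least `A
(s/R)^Q`. Iterating from `R` down to `s` loses `C ^ 2` by a Vitali covering, which `A` absorbs, so
the constant survives the induction. -/

/-! ### Covering and dyadic estimates -/

/-- Lower mass bounds for `E_r` at scale `s` around points of `E` add up over a maximal disjoint
family of balls of radius `s`. -/
theorem mul_measure_thickening_inter_ball_le {X : Type*} [MetricSpace X] [MeasurableSpace X]
    [BorelSpace X] {μ : Measure X} {C κ : ℝ≥0∞} {E : Set X} {z : X} {r s R : ℝ}
    (hpos : ∀ (x : X) (t : ℝ), 0 < t → 0 < μ (Metric.ball x t))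
    (hfin : μ (Metric.ball z R) < ∞)
    (hC : ∀ (x : X) (t : ℝ), 0 < t → μ (Metric.ball x (2 * t)) ≤ C * μ (Metric.ball x t))
    (hs : 0 < s) (hsR : 4 * s ≤ R)
    (hκ : ∀ w ∈ E, κ * μ (Metric.ball w s) ≤ μ (Metric.thickening r E ∩ Metric.ball w s)) :
    κ * μ (Metric.thickening s E ∩ Metric.ball z (R / 2)) ≤
      C ^ 2 * μ (Metric.thickening r E ∩ Metric.ball z R) := by
  obtain ⟨u, hu, hdisj, hcov⟩ := Vitali.exists_disjoint_subfamily_covering_enlargement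
    (fun w : X => Metric.ball w s) (E ∩ Metric.ball z (R / 2 + s)) (fun _ => 1) 2 (by norm_num)
    (fun _ _ => zero_le_one) 1 (fun _ _ => le_rfl) (fun w _ => ⟨w, Metric.mem_ball_self hs⟩)
  have hsub : ∀ w ∈ u, Metric.ball w s ⊆ Metric.ball z R := by
    intro w hw
    have := (hu hw).2
    rw [Metric.mem_ball] at this
    exact Metric.ball_subset_ball' (by linarith)
  have hpair : Pairwise (Function.onFun Disjoint fun w : u => Metric.ball (w : X) s) := by
    intro a b hab
    exact hdisj a.2 b.2 (fun h => hab (Subtype.ext h))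
  have hcount : u.Countable := by
    have : IsFiniteMeasure (μ.restrict (Metric.ball z R)) :=
      ⟨by rwa [Measure.restrict_apply_univ]⟩
    have h := Measure.countable_meas_pos_of_disjoint_iUnion (μ := μ.restrict (Metric.ball z R))
      (As := fun w : u => Metric.ball (w : X) s) (fun _ => measurableSet_ball) hpair
    have huniv : {w : u | 0 < μ.restrict (Metric.ball z R) (Metric.ball (w : X) s)} = univ := by
      refine eq_univ_of_forall fun w => ?_
      rw [mem_ofPred_eq, Measure.restrict_apply measurableSet_ball,
        inter_eq_self_of_subset_left (hsub w w.2)]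
      exact hpos _ _ hs
    rw [huniv, countable_univ_iff] at h
    exact countable_coe_iff.1 h
  -- Three steps of length below `s` lead from `y` to `w`; radius `4s` allows two doublings.
  have hcover : Metric.thickening s E ∩ Metric.ball z (R / 2) ⊆
      ⋃ w ∈ u, Metric.ball w (2 * (2 * s)) := by
    rintro y ⟨hyE, hyz⟩
    obtain ⟨e, he, hye⟩ := Metric.mem_thickening_iff.1 hyE
    rw [Metric.mem_ball] at hyz
    have hez : e ∈ Metric.ball z (R / 2 + s) := by
      rw [Metric.mem_ball]
      linarith [dist_triangle_left e z y]
    obtain ⟨w, hw, ⟨p, hpe, hpw⟩, -⟩ := hcov e ⟨he, hez⟩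
    refine mem_iUnion₂.2 ⟨w, hw, ?_⟩
    rw [Metric.mem_ball] at hpe hpw ⊢
    linarith [dist_triangle y e w, dist_triangle_left e w p]
  have hball : ∀ w : X, μ (Metric.ball w (2 * (2 * s))) ≤ C ^ 2 * μ (Metric.ball w s) := by
    intro w
    calc μ (Metric.ball w (2 * (2 * s))) ≤ C * μ (Metric.ball w (2 * s)) := hC w _ (by linarith)
      _ ≤ C * (C * μ (Metric.ball w s)) := by gcongr; exact hC w s hs
      _ = C ^ 2 * μ (Metric.ball w s) := by ring
  calc κ * μ (Metric.thickening s E ∩ Metric.ball z (R / 2))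
      ≤ κ * μ (⋃ w ∈ u, Metric.ball w (2 * (2 * s))) := by gcongr
    _ ≤ κ * ∑' w : u, μ (Metric.ball (w : X) (2 * (2 * s))) := by
        gcongr
        exact measure_biUnion_le μ hcount _
    _ ≤ κ * ∑' w : u, C ^ 2 * μ (Metric.ball (w : X) s) := by
        gcongr with w
        exact hball w
    _ = C ^ 2 * ∑' w : u, κ * μ (Metric.ball (w : X) s) := by
        rw [ENNReal.tsum_mul_left, ENNReal.tsum_mul_left, mul_left_comm]
    _ ≤ C ^ 2 * ∑' w : u, μ (Metric.thickening r E ∩ Metric.ball (w : X) s) := by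
        gcongr with w
        exact hκ w (hu w.2).1
    _ ≤ C ^ 2 * μ (⋃ w : u, Metric.thickening r E ∩ Metric.ball (w : X) s) := by
        gcongr
        refine tsum_meas_le_meas_iUnion_of_disjoint μ
          (fun w => Metric.isOpen_thickening.measurableSet.inter measurableSet_ball) ?_
        intro a b hab
        exact (hpair hab).mono inter_subset_right inter_subset_right
    _ ≤ C ^ 2 * μ (Metric.thickening r E ∩ Metric.ball z R) := by
        gcongr
        exact iUnion_subset fun w => inter_subset_inter_right _ (hsub w w.2)

/-- If `μ (E_s ∩ B) ≤ A (s / R) ^ Q M` for all `s ∈ (r, R]`, then a dyadic decomposition bounds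
the integral of `dist(·, E) ^ (-α)` over `B \ E_r` whenever `α < Q`. -/
theorem lintegral_compl_thickening_infEDist_rpow_le {X : Type*} [MetricSpace X]
    [MeasurableSpace X] [BorelSpace X] {μ : Measure X} {E B : Set X} (hE : E.Nonempty)
    {α Q A r R : ℝ} {M : ℝ≥0∞} (hα : 0 < α) (hαQ : α < Q) (hA : 0 ≤ A) (hr : 0 < r) (hR : 0 < R)
    (hB : ∀ y ∈ B, Metric.infDist y E < R / 2)
    (hM : ∀ s, r < s → s ≤ R →
      μ (Metric.thickening s E ∩ B) ≤ ENNReal.ofReal (A * (s / R) ^ Q) * M) :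
    ∫⁻ y in B, (Metric.thickening r E)ᶜ.indicator (fun y => Metric.infEDist y E ^ (-α)) y ∂μ ≤
      ENNReal.ofReal (A * 4 ^ α * R ^ (-α) * (1 - (1 / 2 : ℝ) ^ (Q - α))⁻¹) * M := by
  set s : ℕ → ℝ := fun k => (1 / 2 : ℝ) ^ k * R with hs_def
  have hs : ∀ k, 0 < s k := fun k => by positivity
  have hsR : ∀ k, s k ≤ R := fun k =>
    mul_le_of_le_one_left hR.le (pow_le_one₀ (by norm_num) (by norm_num))
  -- Scales at most `r`, where `hM` says nothing, get weight zero; points off `E_r` do not need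
  -- them.
  set a : ℕ → ℝ≥0∞ := fun k => if r < s k then ENNReal.ofReal ((s k / 4) ^ (-α)) else 0 with ha_def
  set θ : ℝ := (1 / 2 : ℝ) ^ (Q - α) with hθ_def
  have hθ0 : 0 ≤ θ := by positivity
  have hθ1 : θ < 1 := Real.rpow_lt_one (by norm_num) (by norm_num) (by linarith)
  have hpt : ∀ y ∈ B, (Metric.thickening r E)ᶜ.indicator (fun y => Metric.infEDist y E ^ (-α)) y ≤
      ∑' k, (Metric.thickening (s k) E).indicator (fun _ => a k) y := by
    intro y hy
    by_cases hyr : y ∈ (Metric.thickening r E)ᶜ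
    swap
    · rw [indicator_of_notMem hyr]; exact zero_le
    rw [indicator_of_mem hyr]
    rw [mem_compl_iff, Metric.mem_thickening_iff_infDist_lt hE, not_lt] at hyr
    set d := Metric.infDist y E with hd_def
    have hd : 0 < d := hr.trans_le hyr
    have hdR := hB y hy
    -- This `k` gives `s k / 4 < d ≤ s k / 2`; the spare factor 2 puts `y` in the open
    -- neighbourhood.
    obtain ⟨k, hk1, hk2⟩ := exists_nat_pow_near_of_lt_one (x := 2 * d / R) (y := (1 / 2 : ℝ))
      (by positivity) (by rw [div_le_one hR]; linarith) (by norm_num) (by norm_num)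
    rw [lt_div_iff₀ hR, pow_succ] at hk1
    rw [div_le_iff₀ hR] at hk2
    have hk1' : s k / 4 < d := by simp only [hs_def]; linarith
    have hk2' : d < s k := by simp only [hs_def]; linarith
    refine le_trans ?_ (ENNReal.le_tsum k)
    rw [indicator_of_mem ((Metric.mem_thickening_iff_infDist_lt hE).2 hk2')]
    simp only [ha_def]
    rw [if_pos (hyr.trans_lt hk2')]
    have hed : Metric.infEDist y E = ENNReal.ofReal d :=
      (ENNReal.ofReal_toReal (Metric.infEDist_ne_top hE)).symm
    rw [hed, ENNReal.ofReal_rpow_of_pos hd]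
    exact ENNReal.ofReal_le_ofReal
      (Real.rpow_le_rpow_of_nonpos (by have := hs k; positivity) hk1'.le (by linarith))
  have hterm : ∀ k, a k * μ (Metric.thickening (s k) E ∩ B) ≤
      ENNReal.ofReal (A * 4 ^ α * R ^ (-α) * θ ^ k) * M := by
    intro k
    simp only [ha_def]
    split_ifs with hk
    swap
    · rw [zero_mul]; exact zero_le
    refine (mul_le_mul_right (hM (s k) hk (hsR k)) _).trans (le_of_eq ?_)
    have hsk := hs k
    rw [← mul_assoc, ← ENNReal.ofReal_mul (by positivity)]
    congr 2
    have h1 : s k / R = (1 / 2 : ℝ) ^ k := by simp only [hs_def]; field_simp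
    have h2 : (s k / 4) ^ (-α) = 4 ^ α * R ^ (-α) * ((1 / 2 : ℝ) ^ k) ^ (-α) := by
      simp only [hs_def]
      rw [Real.div_rpow (by positivity) (by norm_num), Real.mul_rpow (by positivity) hR.le,
        Real.rpow_neg (by norm_num : (0 : ℝ) ≤ 4), div_inv_eq_mul]
      ring
    have h3 : θ ^ k = ((1 / 2 : ℝ) ^ k) ^ (-α) * ((1 / 2 : ℝ) ^ k) ^ Q := by
      rw [← Real.rpow_add (by positivity), hθ_def, ← Real.rpow_mul_natCast (by norm_num),
        ← Real.rpow_natCast_mul (by norm_num)]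
      congr 1
      ring
    rw [h1, h2, h3]
    ring
  calc ∫⁻ y in B, (Metric.thickening r E)ᶜ.indicator (fun y => Metric.infEDist y E ^ (-α)) y ∂μ
      ≤ ∫⁻ y in B, ∑' k, (Metric.thickening (s k) E).indicator (fun _ => a k) y ∂μ := by
        refine setLIntegral_mono ?_ hpt
        exact Measurable.tsum fun k =>
          measurable_const.indicator Metric.isOpen_thickening.measurableSet
    _ = ∑' k, a k * μ (Metric.thickening (s k) E ∩ B) := by
        rw [lintegral_tsum fun k =>
          (measurable_const.indicator Metric.isOpen_thickening.measurableSet).aemeasurable]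
        congr 1 with k
        rw [lintegral_indicator_const Metric.isOpen_thickening.measurableSet,
          Measure.restrict_apply Metric.isOpen_thickening.measurableSet]
    _ ≤ ∑' k, ENNReal.ofReal (A * 4 ^ α * R ^ (-α) * θ ^ k) * M := ENNReal.tsum_le_tsum hterm
    _ = ENNReal.ofReal (A * 4 ^ α * R ^ (-α) * (1 - θ)⁻¹) * M := by
        rw [ENNReal.tsum_mul_right, ← ENNReal.ofReal_tsum_of_nonneg (fun k => by positivity)
          ((summable_geometric_of_lt_one hθ0 hθ1).mul_left _), tsum_mul_left,
          tsum_geometric_of_lt_one hθ0 hθ1]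

/-! ### From the Aikawa condition to mass lower bounds -/

theorem hasAssouadLowerBound_of_upperAikawa {X : Type*} [MetricSpace X] [MeasurableSpace X]
    [BorelSpace X] {μ : Measure X} (hμ : IsDoublingMeasure μ) {E : Set X} (hE : E.Nonempty)
    {α Q : ℝ} (hα : 0 < α) (hαQ : α < Q) (h : UpperAikawa μ E α) :
    HasAssouadLowerBound μ E Q := by
  obtain ⟨C, hC1, hC⟩ := hμ.doubling
  have hC0 : 0 < C := by linarith
  have hQ : 0 < Q := hα.trans hαQ
  -- `4 ^ Q` makes the upper bound trivial for `s > R / 4`; `C ^ 2` pays for the covering.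
  set A : ℝ := max (4 ^ Q) (C ^ 2) with hA_def
  have hA : 0 < A := lt_max_of_lt_left (by positivity)
  set G : ℝ := (1 - (1 / 2 : ℝ) ^ (Q - α))⁻¹ with hG_def
  have hG : 0 < G := inv_pos.2 (sub_pos.2
    (Real.rpow_lt_one (by norm_num) (by norm_num) (by linarith)))
  -- The Aikawa lower bound becomes at least twice the dyadic upper bound.
  set ε : ℝ := (2 * (C * (A * 4 ^ α * G)))⁻¹ with hε_def
  have hε : 0 < ε := by positivity
  obtain ⟨δ, hδ, hAik⟩ := h ε hε
  -- Either `E_r` has large density in `B(z, R)`, or some scale in `(r, R / 4]` gains mass.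
  have dichotomy : ∀ z ∈ E, ∀ r R : ℝ, 0 < r → r < R → ENNReal.ofReal R < radiusBound E →
      ENNReal.ofReal δ * μ (Metric.ball z (R / 2)) ≤
        μ (Metric.thickening r E ∩ Metric.ball z (R / 2)) ∨
      ∃ s, r < s ∧ 4 * s ≤ R ∧ ENNReal.ofReal (A * (s / R) ^ Q) * μ (Metric.ball z R) ≤
        μ (Metric.thickening s E ∩ Metric.ball z (R / 2)) := by
    intro z hz r R hr hrR hRE
    have hR : 0 < R := hr.trans hrR
    by_contra! hcon
    obtain ⟨hcon1, hcon2⟩ := hcon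
    have hAik' := hAik z hz (R / 2) (by positivity)
      ((ENNReal.ofReal_le_ofReal (by linarith)).trans_lt hRE) (Metric.thickening r E)ᶜ
      Metric.isOpen_thickening.measurableSet.compl
      (by rw [sdiff_compl, inter_comm]; exact hcon1.le)
    have hint := lintegral_compl_thickening_infEDist_rpow_le (μ := μ) (B := Metric.ball z (R / 2))
      (M := μ (Metric.ball z R)) hE hα hαQ hA.le hr hR
      (fun y hy => (Metric.infDist_le_dist_of_mem hz).trans_lt hy) (by
        intro s hrs hsR
        by_cases hs4 : 4 * s ≤ R
        · exact (hcon2 s hrs hs4).le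
        have h1 : 1 ≤ A * (s / R) ^ Q := by
          have hs : 0 < s := hr.trans hrs
          calc (1 : ℝ) ≤ (4 * (s / R)) ^ Q := by
                refine Real.one_le_rpow ?_ hQ.le
                rw [← mul_div_assoc, one_le_div hR]
                linarith
            _ = 4 ^ Q * (s / R) ^ Q := Real.mul_rpow (by norm_num) (by positivity)
            _ ≤ A * (s / R) ^ Q := by gcongr; exact le_max_left _ _
        calc μ (Metric.thickening s E ∩ Metric.ball z (R / 2)) ≤ 1 * μ (Metric.ball z R) := by
              rw [one_mul]
              exact measure_mono (inter_subset_right.trans (Metric.ball_subset_ball (by linarith)))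
          _ ≤ ENNReal.ofReal (A * (s / R) ^ Q) * μ (Metric.ball z R) := by
              gcongr
              exact ENNReal.one_le_ofReal.2 h1)
    have hB0 := (hμ.ball_pos z (R / 2) (by positivity)).ne'
    have hBt := (hμ.ball_lt_top z (R / 2) (by positivity)).ne
    rw [setLAverage_eq, ENNReal.le_div_iff_mul_le (Or.inl hB0) (Or.inl hBt)] at hAik'
    have hdbl : μ (Metric.ball z R) ≤ ENNReal.ofReal C * μ (Metric.ball z (R / 2)) := by
      simpa [mul_div_cancel₀] using hC z (R / 2) (by positivity)
    have hle := hAik'.trans (hint.trans (mul_le_mul_right hdbl _))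
    rw [← mul_assoc, ENNReal.mul_le_mul_iff_left hB0 hBt, ← ENNReal.ofReal_mul (by positivity),
      ENNReal.ofReal_le_ofReal_iff (by positivity)] at hle
    have hRα : R ^ (-α) ≤ (R / 2) ^ (-α) :=
      Real.rpow_le_rpow_of_nonpos (by positivity) (by linarith) (by linarith)
    have hRpos : 0 < R ^ (-α) := by positivity
    have : R ^ (-α) * (2 * (C * (A * 4 ^ α * G))) ≤ R ^ (-α) * (C * (A * 4 ^ α * G)) := by
      calc R ^ (-α) * (2 * (C * (A * 4 ^ α * G)))
          ≤ (R / 2) ^ (-α) * (2 * (C * (A * 4 ^ α * G))) := by gcongr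
        _ = (R / 2) ^ (-α) / ε := by rw [hε_def, div_inv_eq_mul]
        _ ≤ _ := hle
        _ = R ^ (-α) * (C * (A * 4 ^ α * G)) := by ring
    have hX : 0 < C * (A * 4 ^ α * G) := by positivity
    linarith [le_of_mul_le_mul_left this hRpos]
  set c : ℝ := δ / C with hc_def
  have hc : 0 < c := by positivity
  -- Induction on the number of doublings from `r` to `R`, with `c` independent of `n`.
  have key : ∀ n : ℕ, ∀ z ∈ E, ∀ r R : ℝ, 0 < r → r < R → R ≤ 2 ^ n * r →
      ENNReal.ofReal R < radiusBound E →
      ENNReal.ofReal (c * (r / R) ^ Q) * μ (Metric.ball z R) ≤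
        μ (Metric.thickening r E ∩ Metric.ball z R) := by
    intro n
    induction n with
    | zero => intro z _ r R _ hrR hRr; linarith
    | succ n ih =>
      intro z hz r R hr hrR hRr hRE
      have hR : 0 < R := hr.trans hrR
      rcases dichotomy z hz r R hr hrR hRE with hbig | ⟨s, hrs, hsR, hs⟩
      · have hdbl : μ (Metric.ball z R) ≤ ENNReal.ofReal C * μ (Metric.ball z (R / 2)) := by
          simpa [mul_div_cancel₀] using hC z (R / 2) (by positivity)
        have h1 : (r / R) ^ Q ≤ 1 :=
          Real.rpow_le_one (by positivity) (by rw [div_le_one hR]; exact hrR.le) hQ.le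
        calc ENNReal.ofReal (c * (r / R) ^ Q) * μ (Metric.ball z R)
            ≤ ENNReal.ofReal c * (ENNReal.ofReal C * μ (Metric.ball z (R / 2))) := by
              gcongr
              exact mul_le_of_le_one_right hc.le h1
          _ = ENNReal.ofReal δ * μ (Metric.ball z (R / 2)) := by
              rw [← mul_assoc, ← ENNReal.ofReal_mul hc.le, hc_def, div_mul_cancel₀ _ hC0.ne']
          _ ≤ μ (Metric.thickening r E ∩ Metric.ball z (R / 2)) := hbig
          _ ≤ μ (Metric.thickening r E ∩ Metric.ball z R) := by
              gcongr
              linarith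
      · have hs0 : 0 < s := hr.trans hrs
        have hcov := mul_measure_thickening_inter_ball_le (κ := ENNReal.ofReal (c * (r / s) ^ Q))
          hμ.ball_pos (hμ.ball_lt_top z R hR) hC hs0 hsR
          (fun w hw => ih w hw r s hr hrs (by rw [pow_succ] at hRr; linarith)
            ((ENNReal.ofReal_le_ofReal (by linarith)).trans_lt hRE))
        have hC2 : ENNReal.ofReal C ^ 2 ≠ 0 := by
          simpa using hC0
        rw [← ENNReal.mul_le_mul_iff_right hC2 (by finiteness)]
        refine le_trans ?_ ((mul_le_mul_right hs _).trans hcov)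
        rw [← mul_assoc, ← mul_assoc]
        refine mul_le_mul_left ?_ _
        rw [← ENNReal.ofReal_pow hC0.le, ← ENNReal.ofReal_mul (by positivity),
          ← ENNReal.ofReal_mul (by positivity)]
        refine ENNReal.ofReal_le_ofReal ?_
        have hrR' : (r / R) ^ Q = (r / s) ^ Q * (s / R) ^ Q := by
          rw [← Real.mul_rpow (by positivity) (by positivity), div_mul_div_cancel₀ hs0.ne']
        calc C ^ 2 * (c * (r / R) ^ Q) ≤ A * (c * (r / R) ^ Q) := by
              gcongr
              exact le_max_right _ _
          _ = c * (r / s) ^ Q * (A * (s / R) ^ Q) := by rw [hrR']; ring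
  refine ⟨c, hc, fun z hz r R hr hrR hRE => ?_⟩
  have hR : 0 < R := hr.trans hrR
  obtain ⟨n, hn⟩ := pow_unbounded_of_one_lt (R / r) (one_lt_two : (1 : ℝ) < 2)
  rw [ENNReal.le_div_iff_mul_le (Or.inl (hμ.ball_pos z R hR).ne')
    (Or.inl (hμ.ball_lt_top z R hR).ne)]
  exact key n z hz r R hr hrR ((div_lt_iff₀ hr).1 hn).le hRE

/-! ### From mass lower bounds to the Aikawa condition -/

theorem upperAikawa_of_hasAssouadLowerBound {X : Type*} [MetricSpace X] [MeasurableSpace X]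
    [BorelSpace X] {μ : Measure X} (hμ : IsDoublingMeasure μ) {E : Set X} {α Q : ℝ}
    (hα : 0 < α) (hQα : Q < α) (h : HasAssouadLowerBound μ E Q) : UpperAikawa μ E α := by
  obtain ⟨c, hc, hQ⟩ := h
  intro ε hε
  obtain ⟨t, ht0, ht1, htε⟩ : ∃ t : ℝ, 0 < t ∧ t < 1 ∧ t ^ (α - Q) ≤ c / 2 * ε := by
    have hlim : Filter.Tendsto (fun t : ℝ => t ^ (α - Q)) (nhdsWithin 0 (Ioi 0)) (nhds 0) := by
      have := (Real.continuousAt_rpow_const 0 (α - Q) (Or.inr (by linarith))).tendsto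
      rw [Real.zero_rpow (by linarith)] at this
      exact this.mono_left nhdsWithin_le_nhds
    have h1 := hlim.eventually (ge_mem_nhds (by positivity : 0 < c / 2 * ε))
    obtain ⟨t, ht, ht01⟩ := (h1.and (Ioo_mem_nhdsGT zero_lt_one)).exists
    exact ⟨t, ht01.1, ht01.2, ht⟩
  -- Half of the relative mass guaranteed for `E_{tR}`, so `K` keeps the other half.
  set δ : ℝ := c / 2 * t ^ Q with hδ_def
  have hδ : 0 < δ := by positivity
  refine ⟨δ, hδ, fun z hz R hR hRE K hK hKδ => ?_⟩
  have hB0 := (hμ.ball_pos z R hR).ne'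
  have hBt := (hμ.ball_lt_top z R hR).ne
  set T : Set X := Metric.thickening (t * R) E with hT_def
  have hT : MeasurableSet T := Metric.isOpen_thickening.measurableSet
  have hlow := hQ z hz (t * R) R (by positivity) (mul_lt_of_lt_one_left hR ht1) hRE
  rw [mul_div_cancel_right₀ _ hR.ne', ENNReal.le_div_iff_mul_le (Or.inl hB0) (Or.inl hBt)] at hlow
  have hTK : ENNReal.ofReal δ * μ (Metric.ball z R) ≤ μ (T ∩ K ∩ Metric.ball z R) := by
    have hfin : ENNReal.ofReal δ * μ (Metric.ball z R) ≠ ∞ := by finiteness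
    rw [← ENNReal.add_le_add_iff_left hfin]
    calc ENNReal.ofReal δ * μ (Metric.ball z R) + ENNReal.ofReal δ * μ (Metric.ball z R)
        = ENNReal.ofReal (c * t ^ Q) * μ (Metric.ball z R) := by
          rw [← add_mul, ← ENNReal.ofReal_add hδ.le hδ.le]
          congr 2
          rw [hδ_def]
          ring
      _ ≤ μ (T ∩ Metric.ball z R) := hlow
      _ ≤ μ ((Metric.ball z R \ K) ∪ (T ∩ K ∩ Metric.ball z R)) := by
          refine measure_mono fun y hy => ?_
          by_cases hyK : y ∈ K
          · exact Or.inr ⟨⟨hy.1, hyK⟩, hy.2⟩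
          · exact Or.inl ⟨hy.2, hyK⟩
      _ ≤ μ (Metric.ball z R \ K) + μ (T ∩ K ∩ Metric.ball z R) := measure_union_le _ _
      _ ≤ ENNReal.ofReal δ * μ (Metric.ball z R) + μ (T ∩ K ∩ Metric.ball z R) := by gcongr
  rw [setLAverage_eq, ENNReal.le_div_iff_mul_le (Or.inl hB0) (Or.inl hBt)]
  have hreal : R ^ (-α) / ε ≤ (t * R) ^ (-α) * δ := by
    rw [div_le_iff₀ hε, Real.mul_rpow ht0.le hR.le]
    have h1 : t ^ (-α) * t ^ Q * t ^ (α - Q) = 1 := by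
      rw [← Real.rpow_add ht0, ← Real.rpow_add ht0]
      simp
    have h2 : 0 < t ^ (-α) * t ^ Q := by positivity
    calc R ^ (-α) = R ^ (-α) * (t ^ (-α) * t ^ Q * t ^ (α - Q)) := by rw [h1, mul_one]
      _ ≤ R ^ (-α) * (t ^ (-α) * t ^ Q * (c / 2 * ε)) := by gcongr
      _ = t ^ (-α) * R ^ (-α) * δ * ε := by rw [hδ_def]; ring
  calc ENNReal.ofReal (R ^ (-α) / ε) * μ (Metric.ball z R)
      ≤ ENNReal.ofReal ((t * R) ^ (-α) * δ) * μ (Metric.ball z R) := by gcongr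
    _ = ENNReal.ofReal ((t * R) ^ (-α)) * (ENNReal.ofReal δ * μ (Metric.ball z R)) := by
        rw [ENNReal.ofReal_mul (by positivity), mul_assoc]
    _ ≤ ENNReal.ofReal ((t * R) ^ (-α)) * μ (T ∩ K ∩ Metric.ball z R) := by gcongr
    _ = ∫⁻ y in Metric.ball z R, (T ∩ K).indicator
          (fun _ => ENNReal.ofReal ((t * R) ^ (-α))) y ∂μ := by
        rw [lintegral_indicator_const (hT.inter hK), Measure.restrict_apply (hT.inter hK)]
    _ ≤ ∫⁻ y in Metric.ball z R, K.indicator (fun y => Metric.infEDist y E ^ (-α)) y ∂μ := by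
        refine lintegral_mono fun y => ?_
        by_cases hy : y ∈ T ∩ K
        · rw [indicator_of_mem hy, indicator_of_mem hy.2,
            ← ENNReal.ofReal_rpow_of_pos (by positivity), ENNReal.rpow_neg, ENNReal.rpow_neg]
          exact ENNReal.inv_le_inv.2
            (ENNReal.rpow_le_rpow (Metric.mem_thickening_iff_infEDist_lt.1 hy.1).le hα.le)
        · rw [indicator_of_notMem hy]
          exact zero_le

theorem theoremt {X : Type*} [MetricSpace X] [MeasurableSpace X] [BorelSpace X]
    (μ : Measure X) (hμ : IsDoublingMeasure μ) (E : Set X) (hE : E.Nonempty) :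
    upperAssouadCodim μ E =
      sInf (ENNReal.ofReal '' {α : ℝ | 0 < α ∧ UpperAikawa μ E α}) := by
  refine le_antisymm (le_sInf ?_) (le_sInf ?_)
  · rintro _ ⟨α, ⟨hα, h⟩, rfl⟩
    refine ENNReal.le_of_forall_pos_le_add fun η hη _ => sInf_le ⟨α + η, ⟨by positivity, ?_⟩, ?_⟩
    · exact hasAssouadLowerBound_of_upperAikawa hμ hE hα
        (lt_add_of_pos_right α (NNReal.coe_pos.2 hη)) h
    · rw [ENNReal.ofReal_add hα.le η.coe_nonneg, ENNReal.ofReal_coe_nnreal]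
  · rintro _ ⟨Q, ⟨hQ, h⟩, rfl⟩
    -- `Q = 0` is allowed but Aikawa exponents are positive.
    have hη' : ∀ η : NNReal, 0 < η → 0 < Q + η := fun η hη =>
      add_pos_of_nonneg_of_pos hQ (NNReal.coe_pos.2 hη)
    refine ENNReal.le_of_forall_pos_le_add fun η hη _ => sInf_le ⟨Q + η, ⟨hη' η hη, ?_⟩, ?_⟩
    · exact upperAikawa_of_hasAssouadLowerBound hμ (hη' η hη)
        (lt_add_of_pos_right Q (NNReal.coe_pos.2 hη)) h
    · rw [ENNReal.ofReal_add hQ η.coe_nonneg, ENNReal.ofReal_coe_nnreal]
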